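/- For non-negative integers $m,n$ put $Q(m,n)=2m^2+6mn+6n^2$. For $N\ge 0$ let $(a;q)_N=\prod_{i=0}^{N-1}(1-aq^i)$, let $(a;q)_\infty=\lim_{N\to\infty}(a;q)_N$, and write $(a,b;q)_\infty=(a;q)_\infty(b;q)_\infty$. Then $$\sum_{m,n\ge 0}\frac{q^{Q(m,n)+m+3n}}{(q;q)_m(q^3;q^3)_n}+\sum_{m,n\ge 0}\frac{q^{Q(m,n)+3m+6n+1}}{(q;q)_m(q^3;q^3)_n}=(-q,-q^5;q^6)_\infty\,(-q^3;q^3)_\infty .$$ This holds for every complex number $q$ with $|q|<1$, both double series being absolutely convergent and the infinite products being convergent; and it holds for a formal variable $q$, as an identity in $\mathbb{Z}[[q]]$, the sums and products converging coefficientwise. -/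

import Mathlib

open Filter Topology
open scoped PowerSeries.WithPiTopology

namespace Capparelli

/-- The finite `q`-Pochhammer symbol `(a; q)_n = (1 - a)(1 - a q) ⋯ (1 - a q ^ (n - 1))`. -/
def qPoch {R : Type*} [CommRing R] (a q : R) (n : ℕ) : R :=
  ∏ i ∈ Finset.range n, (1 - a * q ^ i)

/-- The infinite `q`-Pochhammer symbol `(a; q)_∞`, the limit of `(a; q)_n` as `n → ∞`. -/
noncomputable def qPochInf {R : Type*} [CommRing R] [TopologicalSpace R] (a q : R) : R :=
  @limUnder R _ ℕ ⟨0⟩ atTop (fun n => qPoch a q n)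

/-- The quadratic form `Q(m, n) = 2 m² + 6 m n + 6 n²`. -/
def Q (m n : ℕ) : ℕ := 2 * m ^ 2 + 6 * m * n + 6 * n ^ 2

/-- The summand `q ^ e / ((q; q)_m (q³; q³)_n)`. Here `Ring.inverse` is the inverse of a unit; the
denominator is a unit in both settings of interest, see `isUnit_denom_complex` and
`isUnit_denom_formal`. -/
noncomputable def summand {R : Type*} [CommRing R] (q : R) (e m n : ℕ) : R :=
  q ^ e * Ring.inverse (qPoch q q m * qPoch (q ^ 3) (q ^ 3) n)

theorem isUnit_denom_complex (q : ℂ) (hq : ‖q‖ < 1) (m n : ℕ) :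
    IsUnit (qPoch q q m * qPoch (q ^ 3) (q ^ 3) n) := by
  have key : ∀ k : ℕ, k ≠ 0 → (1 : ℂ) - q ^ k ≠ 0 := by
    intro k hk h
    have h1 : ‖q ^ k‖ = 1 := by rw [← sub_eq_zero.mp h, norm_one]
    rw [norm_pow] at h1
    exact absurd h1 (pow_lt_one₀ (norm_nonneg q) hq hk).ne
  refine (mul_ne_zero ?_ ?_).isUnit
  · refine Finset.prod_ne_zero_iff.mpr fun i _ => ?_
    rw [← pow_succ']
    exact key _ (Nat.succ_ne_zero i)
  · refine Finset.prod_ne_zero_iff.mpr fun i _ => ?_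
    rw [← pow_succ', ← pow_mul]
    exact key _ (by positivity)

theorem isUnit_denom_formal (m n : ℕ) :
    IsUnit (qPoch (PowerSeries.X : PowerSeries ℤ) PowerSeries.X m *
      qPoch ((PowerSeries.X : PowerSeries ℤ) ^ 3) (PowerSeries.X ^ 3) n) := by
  rw [PowerSeries.isUnit_iff_constantCoeff]
  simp [qPoch, map_prod]

/-- The double-sum identity, read in a commutative topological ring at an element `q`: both double
series converge (unconditionally, over all pairs of natural numbers), the three infinite products
converge, and the sum of the two series equals the product of the three products. -/
def DoubleSumIdentity {R : Type*} [CommRing R] [TopologicalSpace R] (q : R) : Prop :=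
  Summable (fun p : ℕ × ℕ => summand q (Q p.1 p.2 + p.1 + 3 * p.2) p.1 p.2) ∧
  Summable (fun p : ℕ × ℕ => summand q (Q p.1 p.2 + 3 * p.1 + 6 * p.2 + 1) p.1 p.2) ∧
  Tendsto (fun N => qPoch (-q) (q ^ 6) N) atTop (𝓝 (qPochInf (-q) (q ^ 6))) ∧
  Tendsto (fun N => qPoch (-q ^ 5) (q ^ 6) N) atTop (𝓝 (qPochInf (-q ^ 5) (q ^ 6))) ∧
  Tendsto (fun N => qPoch (-q ^ 3) (q ^ 3) N) atTop (𝓝 (qPochInf (-q ^ 3) (q ^ 3))) ∧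
  ∑' p : ℕ × ℕ, summand q (Q p.1 p.2 + p.1 + 3 * p.2) p.1 p.2 +
      ∑' p : ℕ × ℕ, summand q (Q p.1 p.2 + 3 * p.1 + 6 * p.2 + 1) p.1 p.2 =
    qPochInf (-q) (q ^ 6) * qPochInf (-q ^ 5) (q ^ 6) * qPochInf (-q ^ 3) (q ^ 3)

end Capparelli

/-! Group both double sums by `s = m + 2n`. Up to `C(m, 2)`, and up to a term linear in `m, n` in
the second sum, the exponent is `3 C(s+1, 2)`. So each sum is obtained from a power series in `z` by
replacing `z^s` with `q^(3 C(s+1, 2))`. Let `E(z) = (-z; q)_∞` (`eulerSeries`) and `G(z) = 1/(z²;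
q³)_∞` (`evenSeries`). The two series are `E(z) G(z)` and `q E(q²z) (1 - z²) G(z)`. Since `E(z) =
(1+z)(1+qz) E(q²z)`, they add up to `(1+q)(1+z) E(q²z) G(z)` (`eulerSeries_combination`).

Sorting factors modulo 3 gives `(1+z) E(q²z) G(z) = T(z)/(z; q³)_∞`, where `T(z) = (-q²z, -q⁴z;
q³)_∞/(q³z²; q⁶)_∞`. The coefficients of `T` are `(-q³; q³)_t S_t` with `S_t` explicit
(`thetaSeries_eq`, `eulerSeries_mul_evenSeries`). After the replacement, summing over the exponent
`l` from `1/(z; q³)_∞` completes `(-q³; q³)_t` to `(-q³; q³)_∞`. What is left, the sum of `q^(3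
C(t+1, 2)) S_t`, is a Cauchy product equal to `(-q⁵, -q⁷; q⁶)_∞`; the prefactor `1+q` turns `(-q⁷;
q⁶)_∞` into `(-q; q⁶)_∞`.

The argument runs in any complete normed commutative ring with `‖1‖ = 1` and `‖q‖ < 1`, which covers
`ℂ` and `ℤ⟦X⟧` with the `X`-adic norm. -/

namespace Capparelli

open Finset PowerSeries

/-! ### Formal series in `z` and their `b`-difference equations -/

section Algebra

variable {R : Type*} [CommRing R]

/-- The inverse of `(b; b)_n`. -/
noncomputable def invPoch (b : R) (n : ℕ) : R := Ring.inverse (qPoch b b n)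

@[simp] lemma qPoch_zero (a b : R) : qPoch a b 0 = 1 := by simp [qPoch]

lemma qPoch_succ (a b : R) (n : ℕ) : qPoch a b (n + 1) = qPoch a b n * (1 - a * b ^ n) := by
  simp [qPoch, prod_range_succ]

@[simp] lemma invPoch_zero (b : R) : invPoch b 0 = 1 := by simp [invPoch]

lemma invPoch_succ {b : R} (hb : ∀ k, IsUnit (1 - b ^ (k + 1))) (n : ℕ) :
    (1 - b ^ (n + 1)) * invPoch b (n + 1) = invPoch b n := by
  rw [invPoch, qPoch_succ, ← pow_succ', Ring.mul_inverse_rev, ← mul_assoc,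
    Ring.mul_inverse_cancel _ (hb n), one_mul, invPoch]

lemma summand_eq (q : R) (e m n : ℕ) :
    summand q e m n = q ^ e * (invPoch q m * invPoch (q ^ 3) n) := by
  rw [summand, Ring.mul_inverse_rev, mul_comm (Ring.inverse _), invPoch, invPoch]

/-- A power series with given constant term is determined by a first-order `b`-difference
equation. -/
lemma eq_of_rescale_eq {b : R} (hb : ∀ k, IsUnit (1 - b ^ (k + 1))) {A B f g : R⟦X⟧}
    (hA : coeff 0 A = 1) (hB : coeff 0 B = 1) (hf : A * rescale b f = B * f)
    (hg : A * rescale b g = B * g) (h0 : coeff 0 f = coeff 0 g) : f = g := by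
  have key : A * rescale b (f - g) = B * (f - g) := by
    rw [map_sub]; linear_combination hf - hg
  -- A factor with constant term 1 does not change the lowest coefficient, so the equation forces
  -- `(1 - b^n)` times that coefficient to vanish.
  have lead : ∀ (n : ℕ) (D h : R⟦X⟧), coeff 0 D = 1 → (∀ m < n, coeff m h = 0) →
      coeff n (D * h) = coeff n h := by
    intro n D h hD hh
    rw [coeff_mul, sum_eq_single (0, n)]
    · rw [hD, one_mul]
    · rintro ⟨i, j⟩ hij hne
      have hij' := mem_antidiagonal.mp hij
      have : j < n := by
        rcases Nat.eq_zero_or_pos i with rfl | hi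
        · exact absurd (by simp_all) hne
        · simp only at hij'; omega
      simp [hh j this]
    · simp
  have h : ∀ n, coeff n (f - g) = 0 := by
    intro n
    induction n using Nat.strong_induction_on with
    | _ n ih =>
      rcases n with _ | n
      · rw [map_sub, h0, sub_self]
      · have h1 := congrArg (coeff (n + 1)) key
        rw [lead _ _ _ hA (fun m hm => by rw [coeff_rescale, ih m hm, mul_zero]),
          lead _ _ _ hB ih, coeff_rescale] at h1
        exact (hb n).mul_right_eq_zero.mp (by linear_combination -h1)
  rw [← sub_eq_zero]
  ext n
  simpa using h n

lemma two_mul_choose_two (n : ℕ) : (2 : ℤ) * (n.choose 2 : ℕ) = n * (n - 1) := by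
  induction n with
  | zero => simp
  | succ n ih => rw [Nat.choose_succ_succ' n 1]; push_cast; simp; linarith

/-- The series `∑ b ^ C(n, 2) zⁿ / (b; b)_n`. -/
noncomputable def eulerSeries (b : R) : R⟦X⟧ := mk fun n => b ^ n.choose 2 * invPoch b n

/-- The series `∑ zⁿ / (b; b)_n`. -/
noncomputable def invEulerSeries (b : R) : R⟦X⟧ := mk fun n => invPoch b n

/-- The series `∑ z²ⁿ / (b; b)_n`. -/
noncomputable def evenSeries (b : R) : R⟦X⟧ := mk fun n => if Even n then invPoch b (n / 2) else 0

lemma eulerSeries_eq {b : R} (hb : ∀ k, IsUnit (1 - b ^ (k + 1))) :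
    eulerSeries b = (1 + X) * rescale b (eulerSeries b) := by
  ext n
  rw [add_mul, one_mul, map_add]
  rcases n with _ | n
  · simp [eulerSeries]
  · rw [coeff_succ_X_mul, coeff_rescale, coeff_rescale, eulerSeries, coeff_mk, coeff_mk,
      ← invPoch_succ hb n, Nat.choose_succ_succ' n 1, Nat.choose_one_right]
    ring

lemma invEulerSeries_eq {b : R} (hb : ∀ k, IsUnit (1 - b ^ (k + 1))) :
    (1 - X) * invEulerSeries b = rescale b (invEulerSeries b) := by
  ext n
  rw [sub_mul, one_mul, map_sub]
  rcases n with _ | n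
  · simp [invEulerSeries]
  · rw [coeff_succ_X_mul, coeff_rescale, invEulerSeries, coeff_mk, coeff_mk, ← invPoch_succ hb n]
    ring

/-- Multiplying by `1 - X²` replaces `z²` by `b z²`: a rescaling by `b^(1/2)` that needs no square
root. -/
lemma evenSeries_sub {b : R} (hb : ∀ k, IsUnit (1 - b ^ (k + 1))) (n : ℕ) :
    coeff n ((1 - X ^ 2) * evenSeries b) =
      if Even n then b ^ (n / 2) * invPoch b (n / 2) else 0 := by
  rw [sub_mul, one_mul, map_sub]
  rcases n with _ | _ | n
  · simp [evenSeries, coeff_X_pow_mul']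
  · simp [evenSeries, coeff_X_pow_mul']
  · rw [show n + 1 + 1 = n + 2 from rfl, coeff_X_pow_mul]
    by_cases hn : Even n
    · have h2 : Even (n + 2) := hn.add (by decide)
      have h3 : (n + 2) / 2 = n / 2 + 1 := by omega
      simp only [evenSeries, coeff_mk, if_pos hn, if_pos h2, h3, ← invPoch_succ hb (n / 2)]
      ring
    · have h2 : ¬ Even (n + 2) := by simpa [Nat.even_add] using hn
      simp [evenSeries, hn, h2]

lemma evenSeries_eq {b : R} (hb : ∀ k, IsUnit (1 - b ^ (k + 1))) :
    (1 - C b * X ^ 2) * ((1 - X ^ 2) * evenSeries b) = rescale b (evenSeries b) := by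
  ext n
  rw [sub_mul, one_mul, map_sub, mul_assoc, coeff_C_mul, evenSeries_sub hb, coeff_rescale]
  rcases n with _ | _ | n
  · simp [evenSeries, coeff_X_pow_mul']
  · simp [evenSeries, coeff_X_pow_mul']
  · rw [show n + 1 + 1 = n + 2 from rfl, coeff_X_pow_mul, evenSeries_sub hb]
    by_cases hn : Even n
    · have h2 : Even (n + 2) := hn.add (by decide)
      obtain ⟨k, rfl⟩ := hn
      have h3 : (k + k + 2) / 2 = k + 1 := by omega
      have h4 : (k + k) / 2 = k := by omega
      have h5 : Even (k + k) := ⟨k, rfl⟩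
      simp only [evenSeries, coeff_mk, if_pos h2, if_pos h5, h3, h4, ← invPoch_succ hb k]
      ring
    · have h2 : ¬ Even (n + 2) := by simpa [Nat.even_add] using hn
      simp [evenSeries, hn, h2]

/-! ### The sums `S_t` and their recurrence -/

/-- The triangular number `d (d - 1) / 2` of an integer. -/
def tri (d : ℤ) : ℕ := (d * (d - 1) / 2).toNat

lemma two_mul_tri (d : ℤ) : 2 * (tri d : ℤ) = d * (d - 1) := by
  have h1 : (2 : ℤ) ∣ d * (d - 1) := by
    simpa using (Int.even_mul_pred_self d).two_dvd
  have h2 : 0 ≤ d * (d - 1) := by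
    rcases le_or_gt d 0 with h | h <;> nlinarith
  rw [tri, Int.toNat_of_nonneg (by omega)]
  omega

/-- The exponent `(3 (k - l)² + k + 5 l) / 2`. -/
def expo (k l : ℕ) : ℕ := 3 * tri (k - l) + 2 * k + l

lemma two_mul_expo (k l : ℕ) : 2 * (expo k l : ℤ) = 3 * ((k : ℤ) - l) ^ 2 + k + 5 * l := by
  have := two_mul_tri (k - l)
  rw [expo]; push_cast; linear_combination 3 * this

lemma expo_succ_left (k l : ℕ) : 6 * l + expo (k + 1) l = 3 * (k + l) + 2 + expo k l := by
  have h1 := two_mul_expo (k + 1) l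
  have h2 := two_mul_expo k l
  zify
  push_cast at h1
  apply mul_left_cancel₀ (two_ne_zero (α := ℤ))
  linear_combination h1 - h2

lemma expo_succ_right (k l : ℕ) : 6 * k + expo k (l + 1) = 3 * (k + l) + 4 + expo k l := by
  have h1 := two_mul_expo k (l + 1)
  have h2 := two_mul_expo k l
  zify
  push_cast at h1
  apply mul_left_cancel₀ (two_ne_zero (α := ℤ))
  linear_combination h1 - h2

lemma expo_succ_succ (k l : ℕ) : expo (k + 1) (l + 1) = 3 + expo k l := by
  have h1 := two_mul_expo (k + 1) (l + 1)
  have h2 := two_mul_expo k l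
  zify
  push_cast at h1
  apply mul_left_cancel₀ (two_ne_zero (α := ℤ))
  linear_combination h1 - h2

/-- The weight `3 C(t+1, 2)` cancels the cross term in `k` and `l`, so the weighted sum factors into
two Euler series. -/
lemma expo_add_choose (k l : ℕ) :
    3 * (k + l + 1).choose 2 + expo k l =
      6 * k.choose 2 + 5 * k + (6 * l.choose 2 + 7 * l) := by
  have h1 := two_mul_expo k l
  have h2 := two_mul_choose_two (k + l + 1)
  have h3 := two_mul_choose_two k
  have h4 := two_mul_choose_two l
  zify
  push_cast at h2
  apply mul_left_cancel₀ (two_ne_zero (α := ℤ))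
  linear_combination h1 + 3 * h2 - 6 * h3 - 6 * h4

/-- The `q⁶`-binomial type sum `∑_{k + l = t} q ^ expo k l / ((q⁶; q⁶)_k (q⁶; q⁶)_l)`. -/
noncomputable def thetaSum (q : R) (t : ℕ) : R :=
  ∑ p ∈ antidiagonal t, q ^ expo p.1 p.2 * (invPoch (q ^ 6) p.1 * invPoch (q ^ 6) p.2)

/-- For `k + l = t + 1`, split `1 - q^(6(t+1)) = q^(6l) (1 - q^(6k)) + (1 - q^(6l))`; each bracket
lowers one index. -/
lemma thetaSum_shift {q : R} (hq : ∀ k, IsUnit (1 - (q ^ 6) ^ (k + 1))) (t : ℕ) :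
    (1 - (q ^ 6) ^ (t + 1)) * thetaSum q (t + 1) = q ^ (3 * t + 2) * thetaSum q t +
      ∑ p ∈ antidiagonal t,
        q ^ expo p.1 (p.2 + 1) * (invPoch (q ^ 6) p.1 * invPoch (q ^ 6) p.2) := by
  have h1 : ∑ p ∈ antidiagonal (t + 1), (q ^ 6) ^ p.2 * (1 - (q ^ 6) ^ p.1) *
      (q ^ expo p.1 p.2 * (invPoch (q ^ 6) p.1 * invPoch (q ^ 6) p.2)) =
      q ^ (3 * t + 2) * thetaSum q t := by
    rw [Finset.Nat.sum_antidiagonal_succ, thetaSum, mul_sum]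
    simp only [pow_zero, sub_self, mul_zero, zero_mul, zero_add]
    refine sum_congr rfl fun p hp => ?_
    obtain rfl := mem_antidiagonal.mp hp
    have := congrArg (q ^ ·) (expo_succ_left p.1 p.2)
    simp only [pow_add q (6 * _), pow_add q (3 * (p.1 + p.2) + 2), pow_mul q 6] at this
    rw [← invPoch_succ hq p.1]
    linear_combination (1 - (q ^ 6) ^ (p.1 + 1)) * invPoch (q ^ 6) (p.1 + 1) *
      invPoch (q ^ 6) p.2 * this
  have h2 : ∑ p ∈ antidiagonal (t + 1), (1 - (q ^ 6) ^ p.2) *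
      (q ^ expo p.1 p.2 * (invPoch (q ^ 6) p.1 * invPoch (q ^ 6) p.2)) =
      ∑ p ∈ antidiagonal t,
        q ^ expo p.1 (p.2 + 1) * (invPoch (q ^ 6) p.1 * invPoch (q ^ 6) p.2) := by
    rw [Finset.Nat.sum_antidiagonal_succ']
    simp only [pow_zero, sub_self, zero_mul, zero_add]
    refine sum_congr rfl fun p _ => ?_
    rw [← invPoch_succ hq p.2]
    ring
  rw [← h1, ← h2, thetaSum, mul_sum, ← sum_add_distrib]
  refine sum_congr rfl fun p hp => ?_
  rw [← mem_antidiagonal.mp hp]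
  ring

/-- The leftover sum of `thetaSum_shift` is split by `1 = (1 - q^(6k)) + q^(6k)`, which closes the
recurrence. -/
lemma thetaSum_succ_succ {q : R} (hq : ∀ k, IsUnit (1 - (q ^ 6) ^ (k + 1))) (t : ℕ) :
    (1 - (q ^ 6) ^ (t + 2)) * thetaSum q (t + 2) =
      (q ^ (3 * t + 5) + q ^ (3 * t + 7)) * thetaSum q (t + 1) + q ^ 3 * thetaSum q t := by
  have h1 : ∑ p ∈ antidiagonal (t + 1), (1 - (q ^ 6) ^ p.1) *
      (q ^ expo p.1 (p.2 + 1) * (invPoch (q ^ 6) p.1 * invPoch (q ^ 6) p.2)) =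
      q ^ 3 * thetaSum q t := by
    rw [Finset.Nat.sum_antidiagonal_succ, thetaSum, mul_sum]
    simp only [pow_zero, sub_self, zero_mul, zero_add]
    refine sum_congr rfl fun p _ => ?_
    rw [← invPoch_succ hq p.1, expo_succ_succ]
    ring
  have h2 : ∑ p ∈ antidiagonal (t + 1), (q ^ 6) ^ p.1 *
      (q ^ expo p.1 (p.2 + 1) * (invPoch (q ^ 6) p.1 * invPoch (q ^ 6) p.2)) =
      q ^ (3 * t + 7) * thetaSum q (t + 1) := by
    rw [thetaSum, mul_sum]
    refine sum_congr rfl fun p hp => ?_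
    have := congrArg (q ^ ·) (expo_succ_right p.1 p.2)
    simp only [mem_antidiagonal.mp hp, pow_add q (6 * _), pow_mul q 6] at this
    linear_combination invPoch (q ^ 6) p.1 * invPoch (q ^ 6) p.2 * this
  rw [thetaSum_shift hq, add_mul, add_assoc, ← h1, ← h2, ← sum_add_distrib]
  refine congrArg₂ (· + ·) rfl (sum_congr rfl fun p _ => ?_)
  ring

@[simp] lemma thetaSum_zero (q : R) : thetaSum q 0 = 1 := by
  simp [thetaSum, expo, tri]

lemma thetaSum_one {q : R} (hq : ∀ k, IsUnit (1 - (q ^ 6) ^ (k + 1))) :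
    (1 - q ^ 6) * thetaSum q 1 = q ^ 2 + q ^ 4 := by
  simpa [expo, tri] using thetaSum_shift hq 0

/-- The series `∑ (-q³; q³)_t S_t zᵗ` with `S_t = thetaSum q t`. -/
noncomputable def thetaSeries (q : R) : R⟦X⟧ :=
  mk fun t => qPoch (-q ^ 3) (q ^ 3) t * thetaSum q t

lemma thetaSeries_eq {q : R} (hq : ∀ k, IsUnit (1 - (q ^ 6) ^ (k + 1))) :
    (1 - C (q ^ 3) * X ^ 2) * thetaSeries q =
      (1 + C (q ^ 2) * X) * (1 + C (q ^ 4) * X) * rescale (q ^ 3) (thetaSeries q) := by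
  have hr : (1 + C (q ^ 2) * X) * (1 + C (q ^ 4) * X) * rescale (q ^ 3) (thetaSeries q) =
      rescale (q ^ 3) (thetaSeries q) + C (q ^ 2 + q ^ 4) * (X * rescale (q ^ 3) (thetaSeries q))
        + C (q ^ 6) * (X ^ 2 * rescale (q ^ 3) (thetaSeries q)) := by
    simp only [map_add, map_pow]; ring
  rw [hr, sub_mul, one_mul, mul_assoc]
  ext n
  simp only [LinearMap.map_sub, LinearMap.map_add, coeff_C_mul]
  rw [coeff_rescale]
  rcases n with _ | _ | n
  · simp [thetaSeries, coeff_X_pow_mul']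
  · have h := thetaSum_one hq
    rw [coeff_succ_X_mul, coeff_rescale, coeff_X_pow_mul',
      coeff_X_pow_mul']
    simp only [thetaSeries, coeff_mk, qPoch_succ, qPoch_zero, thetaSum_zero]
    norm_num
    linear_combination h
  · have h := thetaSum_succ_succ hq n
    rw [show n + 1 + 1 = n + 2 from rfl, coeff_X_pow_mul, coeff_X_pow_mul, coeff_succ_X_mul, coeff_rescale, coeff_rescale]
    simp only [thetaSeries, coeff_mk, qPoch_succ]
    have e1 : q ^ (3 * n + 5) = (q ^ 3) ^ n * q ^ 5 := by ring
    have e2 : q ^ (3 * n + 7) = (q ^ 3) ^ n * q ^ 7 := by ring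
    have e3 : (q ^ 6) ^ (n + 2) = ((q ^ 3) ^ n) ^ 2 * q ^ 12 := by ring
    have e4 : (q ^ 3) ^ (n + 1) = (q ^ 3) ^ n * q ^ 3 := by ring
    have e5 : (q ^ 3) ^ (n + 2) = (q ^ 3) ^ n * q ^ 6 := by ring
    rw [e1, e2, e3] at h
    rw [e4, e5]
    linear_combination qPoch (-q ^ 3) (q ^ 3) n * (1 + q ^ 3 * (q ^ 3) ^ n) * h

/-! ### The two generating-function identities -/

lemma eulerSeries_mul_evenSeries {q : R} (hq : ∀ k, IsUnit (1 - q ^ (k + 1))) :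
    (1 + X) * rescale (q ^ 2) (eulerSeries q) * evenSeries (q ^ 3) =
      invEulerSeries (q ^ 3) * thetaSeries q := by
  have hq' : ∀ j : ℕ, 0 < j → ∀ k, IsUnit (1 - (q ^ j) ^ (k + 1)) := fun j hj k => by
    have := hq (j * (k + 1) - 1)
    rwa [Nat.sub_add_cancel (Nat.mul_pos hj k.succ_pos), pow_mul] at this
  have hE : ∀ j : ℕ, rescale (q ^ j) (eulerSeries q) =
      (1 + C (q ^ j) * X) * rescale (q ^ (j + 1)) (eulerSeries q) := fun j => by
    conv_lhs => rw [eulerSeries_eq hq]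
    rw [map_mul, rescale_rescale, map_add, map_one, rescale_X, ← pow_succ']
  have h2 := hE 2
  have h3 := hE 3
  have h4 := hE 4
  have hG := evenSeries_eq (hq' 3 (by norm_num))
  have he := invEulerSeries_eq (hq' 3 (by norm_num))
  have hC := thetaSeries_eq (hq' 6 (by norm_num))
  have h5 : rescale (q ^ 3) (rescale (q ^ 2) (eulerSeries q)) =
      rescale (q ^ (4 + 1)) (eulerSeries q) := by
    rw [rescale_rescale, ← pow_add]
  -- `A` and `B` are the factors gained when `z` becomes `q³z`; the common factors `1 + X` and `1 +
  -- q³X` are left uncancelled.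
  refine eq_of_rescale_eq (hq' 3 (by norm_num))
    (A := (1 + C (q ^ 2) * X) * (1 + C (q ^ 3) * X) * (1 + C (q ^ 4) * X) * (1 + X))
    (B := (1 - X ^ 2) * (1 - C (q ^ 3) * X ^ 2) * (1 + C (q ^ 3) * X)) ?_ ?_ ?_ ?_ ?_
  · simp
  · simp
  · rw [map_mul, map_mul, map_add, map_one, rescale_X, h5, h2, h3, h4, ← hG]
    ring
  · rw [map_mul, ← he]
    linear_combination -(1 + C (q ^ 3) * X) * (1 + X) * (1 - X) * invEulerSeries (q ^ 3) * hC
  · have h0 : constantCoeff (rescale (q ^ 2) (eulerSeries q)) = 1 := by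
      rw [← coeff_zero_eq_constantCoeff_apply, coeff_rescale]
      simp [eulerSeries]
    simp [h0, evenSeries, invEulerSeries, thetaSeries]

/-- The point is `(1+z)(1+qz) + q(1-z²) = (1+q)(1+z)`. -/
lemma eulerSeries_combination {q : R} (hq : ∀ k, IsUnit (1 - q ^ (k + 1))) :
    eulerSeries q * evenSeries (q ^ 3) +
      C q * (rescale (q ^ 2) (eulerSeries q) * ((1 - X ^ 2) * evenSeries (q ^ 3))) =
      C (1 + q) * (invEulerSeries (q ^ 3) * thetaSeries q) := by
  have h : eulerSeries q = (1 + X) * (1 + C q * X) * rescale (q ^ 2) (eulerSeries q) := by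
    conv_lhs => rw [eulerSeries_eq hq, eulerSeries_eq hq]
    rw [map_mul, map_add, map_one, rescale_rescale, ← sq]
    rw [rescale_X, mul_assoc]
  rw [← eulerSeries_mul_evenSeries hq]
  simp only [map_add, map_one]
  linear_combination evenSeries (q ^ 3) * h

end Algebra

/-! ### Regrouping of double series and Euler's expansion -/

section Analysis

variable {R : Type*} [NormedCommRing R]

lemma hasSum_mul_coeff_mul {w f g : ℕ → R} {S : R}
    (h : HasSum (fun p : ℕ × ℕ => w (p.1 + p.2) * (f p.1 * g p.2)) S) :
    HasSum (fun s => w s * coeff s (mk f * mk g)) S := by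
  have h1 := (HasAntidiagonal.sigmaAntidiagonalEquivProd (A := ℕ)).hasSum_iff.mpr h
  refine h1.sigma fun s => ?_
  rw [coeff_mul, mul_sum, ← sum_coe_sort]
  convert hasSum_fintype _ using 1
  refine sum_congr rfl fun p _ => ?_
  have hp := mem_antidiagonal.mp p.2
  simp [hp]

lemma hasSum_mul_coeff_mul_even {w f g : ℕ → R} {S : R}
    (h : HasSum (fun p : ℕ × ℕ => w (p.1 + 2 * p.2) * (f p.1 * g p.2)) S) :
    HasSum (fun s => w s * coeff s (mk f * mk fun n => if Even n then g (n / 2) else 0)) S := by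
  apply hasSum_mul_coeff_mul
  have hinj : Function.Injective (fun p : ℕ × ℕ => (p.1, 2 * p.2)) := by
    rintro ⟨a, b⟩ ⟨c, d⟩ h
    simp only [Prod.mk.injEq] at h ⊢
    omega
  rw [← hinj.hasSum_iff]
  · convert h using 2 with p
    simp
  · rintro ⟨a, b⟩ hab
    have : ¬ Even b := by
      rintro ⟨k, rfl⟩
      exact hab ⟨(a, k), by simp [two_mul]⟩
    simp [this]

/-- The terms of Euler's expansion of `(-z; b)_∞`. -/
noncomputable def eulerTerm (b z : R) (n : ℕ) : R := b ^ n.choose 2 * z ^ n * invPoch b n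

/-- Euler's series `∑ b ^ C(n, 2) zⁿ / (b; b)_n`. -/
noncomputable def eulerSum (b z : R) : R := ∑' n, eulerTerm b z n

lemma thetaSum_mul_pow (q : R) (t : ℕ) :
    q ^ (3 * (t + 1).choose 2) * thetaSum q t = ∑ p ∈ antidiagonal t,
      eulerTerm (q ^ 6) (q ^ 5) p.1 * eulerTerm (q ^ 6) (q ^ 7) p.2 := by
  rw [thetaSum, mul_sum]
  refine sum_congr rfl fun p hp => ?_
  rw [← mul_assoc, ← pow_add, ← mem_antidiagonal.mp hp, expo_add_choose]
  simp only [eulerTerm]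
  ring

lemma Q_add_eq (m n : ℕ) :
    Q m n + m + 3 * n = 3 * (m + 2 * n + 1).choose 2 + m.choose 2 := by
  have h1 := two_mul_choose_two (m + 2 * n + 1)
  have h2 := two_mul_choose_two m
  rw [Q]
  zify
  push_cast at h1
  apply mul_left_cancel₀ (two_ne_zero (α := ℤ))
  linear_combination -3 * h1 - h2

lemma hasSum_summand_fst {q S : R}
    (h : HasSum (fun p : ℕ × ℕ => summand q (Q p.1 p.2 + p.1 + 3 * p.2) p.1 p.2) S) :
    HasSum (fun s => q ^ (3 * (s + 1).choose 2) *
      coeff s (eulerSeries q * evenSeries (q ^ 3))) S := by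
  refine hasSum_mul_coeff_mul_even (w := fun s => q ^ (3 * (s + 1).choose 2)) ?_
  convert h using 2 with p
  rw [summand_eq, Q_add_eq, pow_add]
  ring

variable [NormOneClass R]

lemma norm_pow_lt_one {b : R} (hb : ‖b‖ < 1) {k : ℕ} (hk : k ≠ 0) : ‖b ^ k‖ < 1 :=
  (norm_pow_le _ _).trans_lt (pow_lt_one₀ (norm_nonneg _) hb hk)

lemma norm_pow_mul_le {b : R} (hb : ‖b‖ < 1) (k : ℕ) (x : R) : ‖b ^ k * x‖ ≤ ‖x‖ :=
  (norm_mul_le _ _).trans <| mul_le_of_le_one_left (norm_nonneg _) <|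
    (norm_pow_le _ _).trans (pow_le_one₀ (norm_nonneg _) hb.le)

lemma norm_eulerTerm_le {b z : R} (hb : ‖b‖ < 1) {C : ℝ} (hC : ∀ n, ‖invPoch b n‖ ≤ C) (n : ℕ) :
    ‖eulerTerm b z n‖ ≤ ‖z‖ ^ n * C := by
  rw [eulerTerm, mul_assoc]
  refine (norm_pow_mul_le hb _ _).trans ((norm_mul_le _ _).trans ?_)
  exact mul_le_mul (norm_pow_le _ _) (hC n) (norm_nonneg _) (by positivity)

lemma norm_pow_mul_lt_one {b z : R} (hb : ‖b‖ < 1) (hz : ‖z‖ < 1) (k : ℕ) : ‖b ^ k * z‖ < 1 :=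
  (norm_pow_mul_le hb k z).trans_lt hz

variable [CompleteSpace R]

lemma isUnit_one_sub_pow_succ {b : R} (hb : ‖b‖ < 1) (k : ℕ) : IsUnit (1 - b ^ (k + 1)) :=
  isUnit_one_sub_of_norm_lt_one <|
    (norm_pow_le _ _).trans_lt (pow_lt_one₀ (norm_nonneg _) hb k.succ_ne_zero)

lemma exists_norm_invPoch_le {b : R} (hb : ‖b‖ < 1) : ∃ C, ∀ n, ‖invPoch b n‖ ≤ C := by
  set r := ‖b‖ with hr
  have hr0 : 0 ≤ r := norm_nonneg b
  have hr1 : 0 < 1 - r := by linarith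
  refine ⟨Real.exp ((1 - r)⁻¹ ^ 2), fun n => ?_⟩
  -- The left side is nonincreasing in `n`: one step costs at most `1/(1 - r^(n+1)) ≤
  -- exp(r^n/(1-r))`, exactly the drop of the exponential.
  have key : ‖invPoch b n‖ * Real.exp (r ^ n * (1 - r)⁻¹ ^ 2) ≤ Real.exp ((1 - r)⁻¹ ^ 2) := by
    induction n with
    | zero => simp
    | succ n ih =>
      refine le_trans ?_ ih
      have hx0 : 0 ≤ r ^ (n + 1) := pow_nonneg hr0 _
      have hxr : r ^ (n + 1) ≤ r := pow_le_of_le_one hr0 hb.le n.succ_ne_zero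
      have h1 : ‖invPoch b (n + 1)‖ * (1 - r ^ (n + 1)) ≤ ‖invPoch b n‖ := by
        have h2 : invPoch b (n + 1) = invPoch b n + b ^ (n + 1) * invPoch b (n + 1) := by
          linear_combination invPoch_succ (isUnit_one_sub_pow_succ hb) n
        have h3 : ‖invPoch b (n + 1)‖ ≤ ‖invPoch b n‖ + r ^ (n + 1) * ‖invPoch b (n + 1)‖ := by
          conv_lhs => rw [h2]
          refine (norm_add_le _ _).trans (add_le_add le_rfl ((norm_mul_le _ _).trans ?_))
          exact mul_le_mul_of_nonneg_right (norm_pow_le _ _) (norm_nonneg _)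
        linarith
      have h4 : 1 ≤ (1 - r ^ (n + 1)) * Real.exp (r ^ n * (1 - r)⁻¹) := by
        have h5 : r ^ n * (1 - r)⁻¹ + 1 ≤ Real.exp (r ^ n * (1 - r)⁻¹) := Real.add_one_le_exp _
        refine le_trans ?_ (mul_le_mul_of_nonneg_left h5 (by linarith))
        have h6 : r ^ (n + 1) ≤ (1 - r ^ (n + 1)) * (r ^ n * (1 - r)⁻¹) := by
          rw [← mul_assoc, ← div_eq_mul_inv, le_div_iff₀ hr1, pow_succ]
          have h7 : r ^ n ≤ 1 := pow_le_one₀ hr0 hb.le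
          have h8 : 0 ≤ r ^ n := pow_nonneg hr0 n
          nlinarith [mul_nonneg h8 hr1.le, mul_nonneg (mul_nonneg h8 hr0) (sub_nonneg.mpr h7),
            mul_nonneg h8 (sub_nonneg.mpr h7)]
        linarith
      have h9 : r ^ n * (1 - r)⁻¹ ^ 2 = r ^ (n + 1) * (1 - r)⁻¹ ^ 2 + r ^ n * (1 - r)⁻¹ := by
        field_simp
        ring
      rw [h9, Real.exp_add]
      calc ‖invPoch b (n + 1)‖ * Real.exp (r ^ (n + 1) * (1 - r)⁻¹ ^ 2)
          ≤ ‖invPoch b (n + 1)‖ * Real.exp (r ^ (n + 1) * (1 - r)⁻¹ ^ 2) *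
            ((1 - r ^ (n + 1)) * Real.exp (r ^ n * (1 - r)⁻¹)) :=
            le_mul_of_one_le_right (by positivity) h4
        _ = ‖invPoch b (n + 1)‖ * (1 - r ^ (n + 1)) *
            (Real.exp (r ^ (n + 1) * (1 - r)⁻¹ ^ 2) * Real.exp (r ^ n * (1 - r)⁻¹)) := by ring
        _ ≤ _ := mul_le_mul_of_nonneg_right h1 (by positivity)
  refine le_trans (le_mul_of_one_le_right (norm_nonneg _) (Real.one_le_exp (by positivity))) key

lemma summable_norm_eulerTerm {b z : R} (hb : ‖b‖ < 1) (hz : ‖z‖ < 1) :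
    Summable fun n => ‖eulerTerm b z n‖ := by
  obtain ⟨C, hC⟩ := exists_norm_invPoch_le hb
  exact Summable.of_nonneg_of_le (fun _ => norm_nonneg _) (norm_eulerTerm_le hb hC)
    ((summable_geometric_of_lt_one (norm_nonneg z) hz).mul_right C)

lemma hasSum_eulerTerm {b z : R} (hb : ‖b‖ < 1) (hz : ‖z‖ < 1) :
    HasSum (eulerTerm b z) (eulerSum b z) :=
  (summable_norm_eulerTerm hb hz).of_norm.hasSum

lemma eulerSum_eq {b z : R} (hb : ‖b‖ < 1) (hz : ‖z‖ < 1) :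
    eulerSum b z = (1 + z) * eulerSum b (b * z) := by
  have hbz : ‖b * z‖ < 1 := by simpa using norm_pow_mul_lt_one hb hz 1
  have h1 := hasSum_eulerTerm hb hz
  have h2 := hasSum_eulerTerm hb hbz
  have h3 := ((hasSum_nat_add_iff' 1).mpr h2).add (h2.mul_left z)
  have h4 := (hasSum_nat_add_iff' 1).mpr h1
  have h5 : ∀ n, eulerTerm b z (n + 1) =
      eulerTerm b (b * z) (n + 1) + z * eulerTerm b (b * z) n := fun n => by
    simp only [eulerTerm]
    rw [← invPoch_succ (isUnit_one_sub_pow_succ hb) n, Nat.choose_succ_succ' n 1,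
      Nat.choose_one_right]
    ring
  simp only [h5] at h4
  have h6 := h4.unique h3
  simp only [range_one, sum_singleton, eulerTerm] at h6
  simp only [Nat.choose_zero_succ, pow_zero] at h6
  linear_combination h6

lemma eulerSum_eq_qPoch_mul {b z : R} (hb : ‖b‖ < 1) (hz : ‖z‖ < 1) (N : ℕ) :
    eulerSum b z = qPoch (-z) b N * eulerSum b (b ^ N * z) := by
  induction N with
  | zero => simp
  | succ N ih =>
    rw [ih, qPoch_succ, eulerSum_eq hb (norm_pow_mul_lt_one hb hz N), ← mul_assoc b, ← pow_succ']
    ring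

lemma tendsto_eulerSum_pow_mul {b z : R} (hb : ‖b‖ < 1) (hz : ‖z‖ < 1) :
    Tendsto (fun N => eulerSum b (b ^ N * z)) atTop (𝓝 1) := by
  obtain ⟨C, hC⟩ := exists_norm_invPoch_le hb
  have hC0 : 0 ≤ C := (norm_nonneg _).trans (hC 0)
  have h1 : (1 : R) = ∑' n : ℕ, if n = 0 then 1 else 0 := by rw [tsum_ite_eq]
  rw [h1]
  refine tendsto_tsum_of_dominated_convergence (bound := fun n => ‖z‖ ^ n * C)
    ((summable_geometric_of_lt_one (norm_nonneg z) hz).mul_right C) (fun n => ?_)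
    (Eventually.of_forall fun N n => (norm_eulerTerm_le hb hC n).trans ?_)
  · have h2 : Tendsto (fun N : ℕ => b ^ N * z) atTop (𝓝 0) := by
      simpa using (tendsto_pow_atTop_nhds_zero_of_norm_lt_one hb).mul_const z
    rcases n with _ | n
    · simp [eulerTerm]
    · simpa [eulerTerm] using ((h2.pow (n + 1)).const_mul (b ^ (n + 1).choose 2)).mul_const
        (invPoch b (n + 1))
  · exact mul_le_mul_of_nonneg_right
      (pow_le_pow_left₀ (norm_nonneg _) (norm_pow_mul_le hb N z) n) hC0

/-- Euler's expansion of `(-z; b)_∞`. -/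
lemma tendsto_qPoch {b z : R} (hb : ‖b‖ < 1) (hz : ‖z‖ < 1) :
    Tendsto (fun N => qPoch (-z) b N) atTop (𝓝 (eulerSum b z)) := by
  have h1 := tendsto_eulerSum_pow_mul hb hz
  -- The tail factor tends to 1, so it is eventually a unit and can be divided out.
  have h2 : Tendsto (fun N => Ring.inverse (eulerSum b (b ^ N * z))) atTop (𝓝 1) := by
    have := (NormedRing.inverse_continuousAt (1 : Rˣ)).tendsto.comp h1
    simpa [Function.comp_def] using this
  have h3 := h2.const_mul (eulerSum b z)
  rw [mul_one] at h3
  refine h3.congr' ?_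
  have hev : ∀ᶠ N in atTop, IsUnit (eulerSum b (b ^ N * z)) :=
    h1.eventually (Units.isOpen.mem_nhds isUnit_one)
  filter_upwards [hev] with N hN
  conv_lhs => rw [eulerSum_eq_qPoch_mul hb hz N]
  rw [mul_assoc, Ring.mul_inverse_cancel _ hN, mul_one]

lemma summable_summand {q : R} (hq : ‖q‖ < 1) {e : ℕ → ℕ → ℕ} (he : ∀ m n, m + n ≤ e m n) :
    Summable fun p : ℕ × ℕ => summand q (e p.1 p.2) p.1 p.2 := by
  have hq3 : ‖q ^ 3‖ < 1 := norm_pow_lt_one hq (by norm_num)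
  obtain ⟨C, hC⟩ := exists_norm_invPoch_le hq
  obtain ⟨D, hD⟩ := exists_norm_invPoch_le hq3
  have hC0 : 0 ≤ C := (norm_nonneg _).trans (hC 0)
  have hg := summable_geometric_of_lt_one (norm_nonneg q) hq
  refine Summable.of_norm_bounded (g := fun p : ℕ × ℕ => ‖q‖ ^ p.1 * ‖q‖ ^ p.2 * (C * D))
    ((hg.mul_of_nonneg hg (fun _ => by positivity) fun _ => by positivity).mul_right _)
    fun p => ?_
  rw [summand_eq]
  refine (norm_mul_le _ _).trans (mul_le_mul ?_ ?_ (norm_nonneg _) (by positivity))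
  · rw [← pow_add]
    exact (norm_pow_le _ _).trans (pow_le_pow_of_le_one (norm_nonneg _) hq.le (he _ _))
  · exact (norm_mul_le _ _).trans (mul_le_mul (hC _) (hD _) (norm_nonneg _) hC0)

lemma hasSum_thetaSum {q : R} (hq : ‖q‖ < 1) :
    HasSum (fun t => q ^ (3 * (t + 1).choose 2) * thetaSum q t)
      (eulerSum (q ^ 6) (q ^ 5) * eulerSum (q ^ 6) (q ^ 7)) := by
  have h6 : ‖q ^ 6‖ < 1 := norm_pow_lt_one hq (by norm_num)
  have h5 := summable_norm_eulerTerm h6 (norm_pow_lt_one hq (k := 5) (by norm_num))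
  have h7 := summable_norm_eulerTerm h6 (norm_pow_lt_one hq (k := 7) (by norm_num))
  simp only [thetaSum_mul_pow]
  rw [eulerSum, eulerSum, tsum_mul_tsum_eq_tsum_sum_antidiagonal_of_summable_norm h5 h7]
  exact (summable_norm_sum_mul_antidiagonal_of_summable_norm h5 h7).of_norm.hasSum

lemma choose_two_add (t l : ℕ) :
    (t + l + 1).choose 2 = (t + 1).choose 2 + l.choose 2 + (t + 1) * l := by
  have h1 := two_mul_choose_two (t + l + 1)
  have h2 := two_mul_choose_two (t + 1)
  have h3 := two_mul_choose_two l
  zify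
  push_cast at h1 h2
  apply mul_left_cancel₀ (two_ne_zero (α := ℤ))
  linear_combination h1 - h2 - h3

lemma hasSum_thetaSeries_mul {q : R} (hq : ‖q‖ < 1) :
    HasSum (fun s => q ^ (3 * (s + 1).choose 2) * coeff s (thetaSeries q * invEulerSeries (q ^ 3)))
      (eulerSum (q ^ 6) (q ^ 5) * eulerSum (q ^ 6) (q ^ 7) * eulerSum (q ^ 3) (q ^ 3)) := by
  have h3 : ‖q ^ 3‖ < 1 := norm_pow_lt_one hq (by norm_num)
  have h6 : ‖q ^ 6‖ < 1 := norm_pow_lt_one hq (by norm_num)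
  have hterm : ∀ t l, q ^ (3 * (t + l + 1).choose 2) *
      (qPoch (-q ^ 3) (q ^ 3) t * thetaSum q t * invPoch (q ^ 3) l) =
      q ^ (3 * (t + 1).choose 2) * thetaSum q t * qPoch (-q ^ 3) (q ^ 3) t *
        eulerTerm (q ^ 3) ((q ^ 3) ^ t * q ^ 3) l := fun t l => by
    rw [choose_two_add, eulerTerm]; ring
  have hsum : Summable fun p : ℕ × ℕ => q ^ (3 * (p.1 + p.2 + 1).choose 2) *
      (qPoch (-q ^ 3) (q ^ 3) p.1 * thetaSum q p.1 * invPoch (q ^ 3) p.2) := by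
    obtain ⟨C, hC⟩ := exists_norm_invPoch_le h3
    obtain ⟨D, hD⟩ := (tendsto_qPoch h3 h3).norm.bddAbove_range
    have hD' : ∀ t, ‖qPoch (-q ^ 3) (q ^ 3) t‖ ≤ D := fun t => hD ⟨t, rfl⟩
    have hC0 : 0 ≤ C := (norm_nonneg _).trans (hC 0)
    have h5 := summable_norm_eulerTerm h6 (norm_pow_lt_one hq (k := 5) (by norm_num))
    have h7 := summable_norm_eulerTerm h6 (norm_pow_lt_one hq (k := 7) (by norm_num))
    have hx := summable_norm_sum_mul_antidiagonal_of_summable_norm h5 h7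
    simp only [← thetaSum_mul_pow] at hx
    have hg := (summable_geometric_of_lt_one (norm_nonneg _) h3).mul_right C
    refine Summable.of_norm_bounded ((hx.mul_right D).mul_of_nonneg hg
      (fun _ => mul_nonneg (norm_nonneg _) ((norm_nonneg _).trans (hD' 0)))
      fun _ => by positivity) fun p => ?_
    rw [hterm]
    refine (norm_mul_le _ _).trans (mul_le_mul ?_ ?_ (norm_nonneg _)
      (mul_nonneg (norm_nonneg _) ((norm_nonneg _).trans (hD' 0))))
    · exact (norm_mul_le _ _).trans (mul_le_mul_of_nonneg_left (hD' _) (norm_nonneg _))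
    · refine (norm_eulerTerm_le h3 hC _).trans (mul_le_mul_of_nonneg_right ?_ hC0)
      exact pow_le_pow_left₀ (norm_nonneg _) (norm_pow_mul_le h3 _ _) _
  have h := hsum.hasSum
  -- For fixed `t` the sum over `l` is the tail `(-q^(3(t+1)); q³)_∞`, which completes `(-q³; q³)_t`
  -- to a product independent of `t`.
  have h' := h.prod_fiberwise (g := fun t => q ^ (3 * (t + 1).choose 2) * thetaSum q t *
      eulerSum (q ^ 3) (q ^ 3)) fun t => by
    simp only [hterm]
    rw [eulerSum_eq_qPoch_mul h3 h3 t, ← mul_assoc]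
    exact (hasSum_eulerTerm h3 (norm_pow_mul_lt_one h3 h3 t)).mul_left _
  rw [← h'.unique ((hasSum_thetaSum hq).mul_right _)]
  exact hasSum_mul_coeff_mul (w := fun s => q ^ (3 * (s + 1).choose 2)) h

/-- The surplus `2m + 3n + 1` accounts for `E(q²z)`, for the factor `1 - z²` on `G`, and for the
prefactor `q`. -/
lemma Q_add_eq' (m n : ℕ) : Q m n + 3 * m + 6 * n + 1 =
    3 * (m + 2 * n + 1).choose 2 + m.choose 2 + (2 * m + 3 * n + 1) := by
  rw [← Q_add_eq]
  omega

lemma hasSum_summand_snd {q S : R} (hq : ‖q‖ < 1)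
    (h : HasSum (fun p : ℕ × ℕ => summand q (Q p.1 p.2 + 3 * p.1 + 6 * p.2 + 1) p.1 p.2) S) :
    HasSum (fun s => q ^ (3 * (s + 1).choose 2) * coeff s (C q *
      (rescale (q ^ 2) (eulerSeries q) * ((1 - X ^ 2) * evenSeries (q ^ 3))))) S := by
  have h3 : ‖q ^ 3‖ < 1 := norm_pow_lt_one hq (by norm_num)
  have e1 : C q * rescale (q ^ 2) (eulerSeries q) =
      PowerSeries.mk fun n => q * ((q ^ 2) ^ n * (q ^ n.choose 2 * invPoch q n)) := by
    ext n
    rw [coeff_C_mul, coeff_rescale, eulerSeries, coeff_mk, coeff_mk]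
  have e2 : (1 - X ^ 2) * evenSeries (q ^ 3) = PowerSeries.mk fun n =>
      if Even n then (q ^ 3) ^ (n / 2) * invPoch (q ^ 3) (n / 2) else 0 := by
    ext n
    rw [evenSeries_sub (isUnit_one_sub_pow_succ h3), coeff_mk]
  rw [← mul_assoc, e1, e2]
  refine hasSum_mul_coeff_mul_even (w := fun s => q ^ (3 * (s + 1).choose 2))
    (g := fun k => (q ^ 3) ^ k * invPoch (q ^ 3) k) ?_
  convert h using 2 with p
  rw [summand_eq, Q_add_eq', pow_add, pow_add, pow_add, pow_add, pow_mul q 2, pow_mul q 3 p.2]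
  ring

/-- The double-sum identity in a complete normed ring. -/
theorem exists_hasSum_tendsto {q : R} (hq : ‖q‖ < 1) : ∃ S₁ S₂ A₁ A₂ A₃ : R,
    HasSum (fun p : ℕ × ℕ => summand q (Q p.1 p.2 + p.1 + 3 * p.2) p.1 p.2) S₁ ∧
    HasSum (fun p : ℕ × ℕ => summand q (Q p.1 p.2 + 3 * p.1 + 6 * p.2 + 1) p.1 p.2) S₂ ∧
    Tendsto (fun N => qPoch (-q) (q ^ 6) N) atTop (𝓝 A₁) ∧
    Tendsto (fun N => qPoch (-q ^ 5) (q ^ 6) N) atTop (𝓝 A₂) ∧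
    Tendsto (fun N => qPoch (-q ^ 3) (q ^ 3) N) atTop (𝓝 A₃) ∧
    S₁ + S₂ = A₁ * A₂ * A₃ := by
  have h3 : ‖q ^ 3‖ < 1 := norm_pow_lt_one hq (by norm_num)
  have h5 : ‖q ^ 5‖ < 1 := norm_pow_lt_one hq (by norm_num)
  have h6 : ‖q ^ 6‖ < 1 := norm_pow_lt_one hq (by norm_num)
  have s1 := (summable_summand hq (e := fun m n => Q m n + m + 3 * n) fun m n => by omega).hasSum
  have s2 := (summable_summand hq (e := fun m n => Q m n + 3 * m + 6 * n + 1)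
    fun m n => by omega).hasSum
  refine ⟨_, _, _, _, _, s1, s2, tendsto_qPoch h6 hq, tendsto_qPoch h6 h5, tendsto_qPoch h3 h3, ?_⟩
  have hl := (hasSum_summand_fst s1).add (hasSum_summand_snd hq s2)
  have hr := (hasSum_thetaSeries_mul hq).mul_left (1 + q)
  have hlr : ∀ s, q ^ (3 * (s + 1).choose 2) * coeff s (eulerSeries q * evenSeries (q ^ 3)) +
      q ^ (3 * (s + 1).choose 2) * coeff s (C q *
        (rescale (q ^ 2) (eulerSeries q) * ((1 - X ^ 2) * evenSeries (q ^ 3)))) =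
      (1 + q) * (q ^ (3 * (s + 1).choose 2) *
        coeff s (thetaSeries q * invEulerSeries (q ^ 3))) := fun s => by
    rw [← mul_add, ← LinearMap.map_add, eulerSeries_combination (isUnit_one_sub_pow_succ hq),
      coeff_C_mul, mul_comm (thetaSeries q)]
    ring
  simp only [hlr] at hl
  -- Here `1 + q` is absorbed: `(-q; q⁶)_∞ = (1+q) (-q⁷; q⁶)_∞`.
  rw [hl.unique hr, eulerSum_eq h6 hq, ← pow_succ]
  ring

end Analysis

lemma DoubleSumIdentity.of_hasSum {R : Type*} [CommRing R] [TopologicalSpace R] [T2Space R]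
    {q S₁ S₂ A₁ A₂ A₃ : R}
    (s1 : HasSum (fun p : ℕ × ℕ => summand q (Q p.1 p.2 + p.1 + 3 * p.2) p.1 p.2) S₁)
    (s2 : HasSum (fun p : ℕ × ℕ => summand q (Q p.1 p.2 + 3 * p.1 + 6 * p.2 + 1) p.1 p.2) S₂)
    (t1 : Tendsto (fun N => qPoch (-q) (q ^ 6) N) atTop (𝓝 A₁))
    (t2 : Tendsto (fun N => qPoch (-q ^ 5) (q ^ 6) N) atTop (𝓝 A₂))
    (t3 : Tendsto (fun N => qPoch (-q ^ 3) (q ^ 3) N) atTop (𝓝 A₃))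
    (h : S₁ + S₂ = A₁ * A₂ * A₃) : DoubleSumIdentity q := by
  have e1 : qPochInf (-q) (q ^ 6) = A₁ := t1.limUnder_eq
  have e2 : qPochInf (-q ^ 5) (q ^ 6) = A₂ := t2.limUnder_eq
  have e3 : qPochInf (-q ^ 3) (q ^ 3) = A₃ := t3.limUnder_eq
  refine ⟨s1.summable, s2.summable, ?_, ?_, ?_, ?_⟩
  · rwa [e1]
  · rwa [e2]
  · rwa [e3]
  · rw [s1.tsum_eq, s2.tsum_eq, e1, e2, e3, h]

/-! ### The `X`-adic norm and transfer to coefficientwise convergence -/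

section Formal

open Classical in
/-- The `X`-adic norm `2 ^ (-order f)` on `ℤ⟦X⟧`. -/
noncomputable def adicNorm (f : ℤ⟦X⟧) : ℝ := if f = 0 then 0 else (1 / 2) ^ f.order.toNat

lemma adicNorm_le_iff (f : ℤ⟦X⟧) (n : ℕ) : adicNorm f ≤ (1 / 2) ^ n ↔ X ^ n ∣ f := by
  rw [adicNorm]
  split_ifs with h
  · simp [h]
  · rw [pow_le_pow_iff_right_of_lt_one₀ (by norm_num) (by norm_num), X_pow_dvd_iff]
    constructor
    · intro hn m hm
      refine coeff_of_lt_order_toNat _ (hm.trans_le hn)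
    · intro hn
      by_contra! hlt
      exact coeff_order h (hn _ hlt)

lemma adicNorm_nonneg (f : ℤ⟦X⟧) : 0 ≤ adicNorm f := by
  rw [adicNorm]; split_ifs <;> positivity

lemma adicNorm_eq_zero_or (f : ℤ⟦X⟧) : f = 0 ∨ ∃ n : ℕ, adicNorm f = (1 / 2) ^ n := by
  by_cases h : f = 0
  · exact Or.inl h
  · exact Or.inr ⟨_, if_neg h⟩

lemma adicNorm_zero : adicNorm 0 = 0 := if_pos rfl

lemma adicNorm_neg (f : ℤ⟦X⟧) : adicNorm (-f) = adicNorm f := by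
  rcases eq_or_ne f 0 with rfl | hf
  · rw [neg_zero]
  · rw [adicNorm, adicNorm, if_neg hf, if_neg (neg_ne_zero.mpr hf), order_neg]

lemma adicNorm_add_le (f g : ℤ⟦X⟧) : adicNorm (f + g) ≤ adicNorm f + adicNorm g := by
  rcases adicNorm_eq_zero_or f with rfl | ⟨m, hm⟩
  · simp [adicNorm_zero]
  rcases adicNorm_eq_zero_or g with rfl | ⟨n, hn⟩
  · simp [adicNorm_zero]
  rcases le_total m n with h | h
  · refine le_trans ((adicNorm_le_iff _ m).mpr (dvd_add ?_ ?_))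
      (hm ▸ le_add_of_nonneg_right (adicNorm_nonneg g))
    · exact (adicNorm_le_iff _ _).mp hm.le
    · exact (pow_dvd_pow _ h).trans ((adicNorm_le_iff _ _).mp hn.le)
  · refine le_trans ((adicNorm_le_iff _ n).mpr (dvd_add ?_ ?_))
      (hn ▸ le_add_of_nonneg_left (adicNorm_nonneg f))
    · exact (pow_dvd_pow _ h).trans ((adicNorm_le_iff _ _).mp hm.le)
    · exact (adicNorm_le_iff _ _).mp hn.le

lemma adicNorm_mul_le (f g : ℤ⟦X⟧) : adicNorm (f * g) ≤ adicNorm f * adicNorm g := by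
  rcases adicNorm_eq_zero_or f with rfl | ⟨m, hm⟩
  · simp [adicNorm_zero]
  rcases adicNorm_eq_zero_or g with rfl | ⟨n, hn⟩
  · simp [adicNorm_zero]
  rw [hm, hn, ← pow_add, adicNorm_le_iff, pow_add]
  exact mul_dvd_mul ((adicNorm_le_iff _ _).mp hm.le) ((adicNorm_le_iff _ _).mp hn.le)

/-- `ℤ⟦X⟧` as a normed ring, with the `X`-adic norm. -/
@[reducible] noncomputable def adicNormedCommRing : NormedCommRing ℤ⟦X⟧ :=
  { RingNorm.toNormedRing
      { toFun := adicNorm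
        map_zero' := adicNorm_zero
        add_le' := adicNorm_add_le
        neg' := adicNorm_neg
        mul_le' := adicNorm_mul_le
        eq_zero_of_map_eq_zero' := fun f hf => by
          by_contra h
          rw [adicNorm, if_neg h] at hf
          exact absurd hf (by positivity) } with
    mul_comm := mul_comm }

lemma coeff_eq_of_adicNorm_sub_lt {f g : ℤ⟦X⟧} {n k : ℕ} (h : adicNorm (f - g) < (1 / 2) ^ n)
    (hk : k ≤ n) : coeff k f = coeff k g := by
  have h1 : X ^ (n + 1) ∣ f - g := by
    rcases adicNorm_eq_zero_or (f - g) with h0 | ⟨m, hm⟩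
    · simp [h0]
    · rw [hm, pow_lt_pow_iff_right_of_lt_one₀ (by norm_num) (by norm_num)] at h
      rw [← adicNorm_le_iff, hm]
      exact pow_le_pow_of_le_one (by norm_num) (by norm_num) h
  have := X_pow_dvd_iff.mp h1 k (by omega)
  rwa [map_sub, sub_eq_zero] at this

lemma completeSpace_adic : @CompleteSpace ℤ⟦X⟧ adicNormedCommRing.toUniformSpace := by
  let := adicNormedCommRing
  refine Metric.complete_of_convergent_controlled_sequences (fun n => (1 / 2 : ℝ) ^ n)
    (fun n => by positivity) fun u hu => ⟨mk fun k => coeff k (u k), ?_⟩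
  have hu' : ∀ n k, k ≤ n → coeff k (u n) = coeff k (u k) := fun n k hk => by
    have h : adicNorm (u n - u k) < (1 / 2) ^ k := by
      have := hu k n k hk le_rfl
      rwa [dist_eq_norm] at this
    exact coeff_eq_of_adicNorm_sub_lt h le_rfl
  -- Coefficient `k` is frozen from index `k` on, so the diagonal series is the limit.
  rw [tendsto_iff_norm_sub_tendsto_zero]
  refine squeeze_zero (fun n => norm_nonneg _) (fun n => ?_)
    (tendsto_pow_atTop_nhds_zero_of_lt_one (r := (1 / 2 : ℝ)) (by norm_num) (by norm_num))
  refine (adicNorm_le_iff _ n).mpr (X_pow_dvd_iff.mpr fun k hk => ?_)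
  rw [map_sub, coeff_mk, hu' n k hk.le, sub_self]

/-- Only this direction is needed: `X`-adic limits are also coefficientwise limits. -/
lemma nhds_adic_le (f : ℤ⟦X⟧) :
    @nhds ℤ⟦X⟧ adicNormedCommRing.toUniformSpace.toTopologicalSpace f ≤ 𝓝 f := by
  have h : Tendsto id (@nhds ℤ⟦X⟧ adicNormedCommRing.toUniformSpace.toTopologicalSpace f)
      (𝓝 f) := by
    rw [PowerSeries.WithPiTopology.tendsto_iff_coeff_tendsto]
    intro d
    refine tendsto_nhds_of_eventually_eq ?_
    let := adicNormedCommRing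
    filter_upwards [Metric.ball_mem_nhds f (ε := (1 / 2) ^ d) (by positivity)] with g hg
    rw [Metric.mem_ball, dist_eq_norm] at hg
    exact coeff_eq_of_adicNorm_sub_lt hg le_rfl
  exact h

lemma exists_hasSum_tendsto_adic : ∃ S₁ S₂ A₁ A₂ A₃ : ℤ⟦X⟧,
    HasSum (fun p : ℕ × ℕ => summand (X : ℤ⟦X⟧) (Q p.1 p.2 + p.1 + 3 * p.2) p.1 p.2) S₁ ∧
    HasSum (fun p : ℕ × ℕ =>
      summand (X : ℤ⟦X⟧) (Q p.1 p.2 + 3 * p.1 + 6 * p.2 + 1) p.1 p.2) S₂ ∧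
    Tendsto (fun N => qPoch (-X : ℤ⟦X⟧) (X ^ 6) N) atTop (𝓝 A₁) ∧
    Tendsto (fun N => qPoch (-X ^ 5 : ℤ⟦X⟧) (X ^ 6) N) atTop (𝓝 A₂) ∧
    Tendsto (fun N => qPoch (-X ^ 3 : ℤ⟦X⟧) (X ^ 3) N) atTop (𝓝 A₃) ∧
    S₁ + S₂ = A₁ * A₂ * A₃ := by
  have hone : adicNorm 1 = 1 := by simp [adicNorm]
  have hX : adicNorm X < 1 := by
    have := (adicNorm_le_iff X 1).mpr (by simp)
    linarith
  obtain ⟨S₁, S₂, A₁, A₂, A₃, s1, s2, t1, t2, t3, h⟩ :=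
    @exists_hasSum_tendsto ℤ⟦X⟧ adicNormedCommRing
      (letI := adicNormedCommRing; ⟨hone⟩) completeSpace_adic X hX
  exact ⟨S₁, S₂, A₁, A₂, A₃, s1.trans (nhds_adic_le _), s2.trans (nhds_adic_le _),
    t1.trans (nhds_adic_le _), t2.trans (nhds_adic_le _), t3.trans (nhds_adic_le _), h⟩

end Formal

end Capparelli

theorem mainTheorem6 :
    (∀ q : ℂ, ‖q‖ < 1 → Capparelli.DoubleSumIdentity q) ∧
    Capparelli.DoubleSumIdentity (PowerSeries.X : PowerSeries ℤ) := by
  constructor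
  · intro q hq
    obtain ⟨_, _, _, _, _, s1, s2, t1, t2, t3, h⟩ := Capparelli.exists_hasSum_tendsto hq
    exact .of_hasSum s1 s2 t1 t2 t3 h
  · obtain ⟨_, _, _, _, _, s1, s2, t1, t2, t3, h⟩ := Capparelli.exists_hasSum_tendsto_adic
    exact .of_hasSum s1 s2 t1 t2 t3 h
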